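/- Let $m\ge 1$ and let $G$ be a finite abelian subgroup of $\mathrm{SL}(m,\mathbb C)$. Let $f:\mathrm{GL}(m-1,\mathbb C)\to \mathrm{SL}(m,\mathbb C)$ be the embedding $f(g)=\begin{pmatrix} g&0\\0&\det(g)^{-1}\end{pmatrix}$. Then there are a finite subgroup $G'\subset \mathrm{GL}(m-1,\mathbb C)$ and $P\in\mathrm{SL}(m,\mathbb C)$ with $G=P\,f(G')\,P^{-1}$, and the McKay quiver of $G$ is obtained from that of $G'$ by replacing the Nakayama translation with arrows. More precisely, let $\varphi:G'\to G$ be the isomorphism $g\mapsto P f(g)P^{-1}$ and identify, through $\varphi$, the irreducible representations of $G$ with those of $G'$. Under this identification the McKay quiver $Q_G$ is isomorphic, by an isomorphism that is the identity on vertices, to the quiver obtained from $Q_{G'}$ by adding one arrow $\sigma i\to i$ for every vertex $i$, where $\sigma$ is the Nakayama translation (in particular a permutation of the vertices) of $Q_{G'}$. Here, for a finite group $\Gamma\subset \mathrm{GL}(V)$, the McKay quiver $Q_\Gamma$ has as vertices the isomorphism classes of irreducible complex representations $S_i$ of $\Gamma$, and $a_{i,j}$ arrows from $i$ to $j$, where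 $V\otimes S_i\cong\bigoplus_j a_{i,j}S_j$. The Nakayama translation sends $i$ to the vertex $\sigma i$ such that the socle of the projective cover of the simple module associated to $i$ is the simple module associated to $\sigma i$; the modules are left modules over the skew group algebra $\bigwedge V*\Gamma$, and the simple module associated to a vertex $j$ is $S_j$ with $V$ acting by zero. -/

import Mathlib

open scoped TensorProduct DirectSum

noncomputable section

namespace McKay

/-! ### The natural representation and the embedding `GL(n, ℂ) → SL(n + 1, ℂ)` -/

/-- The representation of `Γ` on `ℂ^m` given by a homomorphism `Γ → GL(m, ℂ)`:
`g` acts on column vectors through its matrix. -/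
def matRep {Γ : Type} [Group Γ] {m : ℕ} (r : Γ →* GL (Fin m) ℂ) :
    Representation ℂ Γ (Fin m → ℂ) :=
  ((Matrix.toLinAlgEquiv' : Matrix (Fin m) (Fin m) ℂ ≃ₐ[ℂ] _) : _ →* _).comp
    ((Units.coeHom _).comp r)

theorem matRep_apply {Γ : Type} [Group Γ] {m : ℕ} (r : Γ →* GL (Fin m) ℂ) (g : Γ)
    (v : Fin m → ℂ) : matRep r g v = (r g : Matrix (Fin m) (Fin m) ℂ).mulVec v := rfl

/-- The natural representation of a subgroup of `GL(m, ℂ)` on `ℂ^m`. -/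
def glRep {m : ℕ} (G : Subgroup (GL (Fin m) ℂ)) : Representation ℂ G (Fin m → ℂ) :=
  matRep G.subtype

/-- The natural representation of a subgroup of `SL(m, ℂ)` on `ℂ^m`. -/
def slRep {m : ℕ} (G : Subgroup (Matrix.SpecialLinearGroup (Fin m) ℂ)) :
    Representation ℂ G (Fin m → ℂ) :=
  matRep (Matrix.SpecialLinearGroup.toGL.comp G.subtype)

/-- The matrix `diag(A, (det A)⁻¹)` of size `n + 1`. -/
def detBlock {n : ℕ} (A : Matrix (Fin n) (Fin n) ℂ) : Matrix (Fin (n + 1)) (Fin (n + 1)) ℂ :=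
  Matrix.reindexAlgEquiv ℂ ℂ finSumFinEquiv
    (Matrix.fromBlocks A 0 0 (Matrix.diagonal fun _ : Fin 1 => (A.det)⁻¹))

/-- The embedding `GL(n, ℂ) → SL(n + 1, ℂ)`, `g ↦ diag(g, (det g)⁻¹)`. -/
def detEmbedding (n : ℕ) : GL (Fin n) ℂ →* Matrix.SpecialLinearGroup (Fin (n + 1)) ℂ where
  toFun g := ⟨detBlock (g : Matrix (Fin n) (Fin n) ℂ), by
    have h : (g : Matrix (Fin n) (Fin n) ℂ).det ≠ 0 :=
      ((Matrix.isUnit_iff_isUnit_det _).1 g.isUnit).ne_zero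
    simp [detBlock, Matrix.det_fromBlocks_zero₂₁, h]⟩
  map_one' := by
    apply Subtype.ext
    change detBlock _ = 1
    simp only [detBlock, Units.val_one, Matrix.det_one, inv_one, Matrix.diagonal_one,
      Matrix.fromBlocks_one, map_one]
  map_mul' g h := by
    apply Subtype.ext
    change detBlock _ = detBlock _ * detBlock _
    simp only [detBlock, Units.val_mul]
    rw [← map_mul, Matrix.fromBlocks_multiply]
    simp [mul_comm]

/-! ### Irreducible representations and the McKay quiver -/

/-- A finite-dimensional irreducible complex representation of `Γ`. -/
structure Irrep (Γ : Type) [Group Γ] where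
  carrier : Type
  [addCommGroup : AddCommGroup carrier]
  [module : Module ℂ carrier]
  [finiteDimensional : FiniteDimensional ℂ carrier]
  ρ : Representation ℂ Γ carrier
  irreducible : ρ.IsIrreducible

attribute [instance] Irrep.addCommGroup Irrep.module Irrep.finiteDimensional Irrep.irreducible

/-- Isomorphism of irreducible representations. -/
instance irrepSetoid (Γ : Type) [Group Γ] : Setoid (Irrep Γ) where
  r S T := Nonempty (S.ρ.Equiv T.ρ)
  iseqv := ⟨fun S => ⟨.refl S.ρ⟩, fun ⟨e⟩ => ⟨e.symm⟩, fun ⟨e⟩ ⟨f⟩ => ⟨e.trans f⟩⟩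

/-- The set of isomorphism classes of irreducible representations of `Γ`. -/
def IrrClass (Γ : Type) [Group Γ] : Type 1 := Quotient (irrepSetoid Γ)

/-- The class of an irreducible representation. -/
def Irrep.cls {Γ : Type} [Group Γ] (S : Irrep Γ) : IrrClass Γ := Quotient.mk _ S

/-- A chosen representative `S_i` of the class `i`. -/
def IrrClass.rep {Γ : Type} [Group Γ] (i : IrrClass Γ) : Irrep Γ := Quotient.out i

section quiver

variable {Γ : Type} [Group Γ] {W : Type} [AddCommGroup W] [Module ℂ W]

/-- The multiplicity of the irreducible representation `S_j` in `V ⊗ S_i`. -/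
def mult (V : Representation ℂ Γ W) (i j : IrrClass Γ) : ℕ :=
  Module.finrank ℂ (Representation.IntertwiningMap j.rep.ρ (V.tprod i.rep.ρ))

/-- The McKay quiver of `Γ` with respect to a representation `V`: the vertices are the isomorphism
classes of irreducible representations of `Γ`, and there are `a_{i,j}` arrows from `i` to `j`,
where `V ⊗ S_i ≅ ⨁_j a_{i,j} S_j`. -/
@[reducible] def mcKayQuiver (V : Representation ℂ Γ W) : Quiver (IrrClass Γ) where
  Hom i j := Fin (mult V i j)

/-- The quiver obtained from `Q` by adding, for every vertex `j`, one arrow from `σ j` to `j`. -/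
@[reducible] def addTranslationArrows {X : Type 1} (Q : Quiver.{0} X) (σ : Equiv.Perm X) :
    Quiver.{0} X where
  Hom i j := Q.Hom i j ⊕ PLift (i = σ j)

/-- The bijection `Φ` on vertices extends to an isomorphism of quivers `Q ≅ R`. -/
def IsQuiverIso {X Y : Type 1} (Q : Quiver.{0} X) (R : Quiver.{0} Y) (Φ : X ≃ Y) : Prop :=
  ∀ i j : X, Nonempty (Q.Hom i j ≃ R.Hom (Φ i) (Φ j))

end quiver

section multiplicity

open Representation

variable {Γ : Type} [Group Γ]

theorem cls_rep_equiv (S : Irrep Γ) : Nonempty (S.cls.rep.ρ.Equiv S.ρ) := Quotient.mk_out S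

theorem finrank_intertwining_congr {A A' B B' : Type} [AddCommGroup A] [Module ℂ A]
    [AddCommGroup A'] [Module ℂ A'] [AddCommGroup B] [Module ℂ B] [AddCommGroup B'] [Module ℂ B']
    {α : Representation ℂ Γ A} {α' : Representation ℂ Γ A'} {β : Representation ℂ Γ B}
    {β' : Representation ℂ Γ B'} (e : α.Equiv α') (f : β.Equiv β') :
    Module.finrank ℂ (IntertwiningMap α β) = Module.finrank ℂ (IntertwiningMap α' β') :=
  LinearEquiv.finrank_eq
    { toFun := fun t => (f.toIntertwiningMap.comp t).comp e.symm.toIntertwiningMap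
      invFun := fun t => (f.symm.toIntertwiningMap.comp t).comp e.toIntertwiningMap
      map_add' := fun s t => by ext x; simp
      map_smul' := fun c t => by ext x; simp
      left_inv := fun t => by ext x; simp
      right_inv := fun t => by ext x; simp }

theorem finrank_intertwining_directSum {B : Type} [AddCommGroup B] [Module ℂ B]
    (β : Representation ℂ Γ B) {ι : Type} [Fintype ι] [DecidableEq ι] (U : ι → Irrep Γ)
    [FiniteDimensional ℂ B] :
    Module.finrank ℂ (IntertwiningMap β (Representation.directSum fun k => (U k).ρ)) =
      ∑ k, Module.finrank ℂ (IntertwiningMap β (U k).ρ) := by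
  have hfin : ∀ k, FiniteDimensional ℂ (IntertwiningMap β (U k).ρ) := fun k =>
    FiniteDimensional.of_injective
      ({ toFun := fun t => t.toLinearMap
         map_add' := fun _ _ => rfl
         map_smul' := fun _ _ => rfl } : IntertwiningMap β (U k).ρ →ₗ[ℂ] (B →ₗ[ℂ] (U k).carrier))
      (IntertwiningMap.toLinearMap_injective _ _)
  have hlin : ∀ (y : ∀ k, (U k).carrier) (k : ι), (DirectSum.linearEquivFunOnFintype ℂ ι
      (fun k => (U k).carrier)).symm y k = y k := fun y k =>
    congrFun ((DirectSum.linearEquivFunOnFintype ℂ ι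
      (fun k => (U k).carrier)).apply_symm_apply y) k
  have hcomp : ∀ (y : ⨁ k, (U k).carrier) (k : ι),
      DirectSum.component ℂ ι (fun k => (U k).carrier) k y = y k := fun _ _ => rfl
  rw [← Module.finrank_pi_fintype]
  exact LinearEquiv.finrank_eq
    { toFun := fun t k =>
        { toLinearMap := (DirectSum.component ℂ ι (fun k => (U k).carrier) k).comp t.toLinearMap
          isIntertwining' := fun g => by
            ext x
            have h := congrArg (DirectSum.component ℂ ι (fun k => (U k).carrier) k)
              (IntertwiningMap.isIntertwining _ _ t g x)
            exact h.trans (DirectSum.lmap_apply (fun k => (U k).ρ g) (t x) k) }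
      map_add' := fun s t => by ext k x; simp
      map_smul' := fun c t => by ext k x; simp
      invFun := fun t =>
        { toLinearMap := (DirectSum.linearEquivFunOnFintype ℂ ι
            (fun k => (U k).carrier)).symm.toLinearMap.comp
              (LinearMap.pi fun k => (t k).toLinearMap)
          isIntertwining' := fun g => by
            ext x k
            simpa [hlin] using IntertwiningMap.isIntertwining _ _ (t k) g x }
      left_inv := fun t => by ext x k; simp [hcomp, hlin]
      right_inv := fun t => by ext k x; simp [hcomp, hlin] }

theorem finrank_intertwining (S T : Irrep Γ) [Decidable (S.cls = T.cls)] :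
    Module.finrank ℂ (IntertwiningMap S.ρ T.ρ) = if S.cls = T.cls then 1 else 0 := by
  split_ifs with h
  · obtain ⟨e⟩ : Nonempty (S.ρ.Equiv T.ρ) := Quotient.exact h
    rw [finrank_intertwining_congr (.refl S.ρ) e.symm]
    exact IsIrreducible.finrank_intertwiningMap_self S.ρ
  · have : IsEmpty (S.ρ.Equiv T.ρ) := ⟨fun e => h (Quotient.sound ⟨e⟩)⟩
    exact Module.finrank_zero_of_subsingleton

/-- If `V ⊗ S` decomposes as the direct sum of irreducible representations `U k`, then the number of
arrows from `[S]` to `[T]` in the McKay quiver is the number of `k` with `U k ≅ T`. -/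
theorem mult_eq_card {W : Type} [AddCommGroup W] [Module ℂ W] (V : Representation ℂ Γ W)
    (S T : Irrep Γ) {ι : Type} [Fintype ι] [DecidableEq ι] (U : ι → Irrep Γ)
    (e : (V.tprod S.ρ).Equiv (Representation.directSum fun k => (U k).ρ)) :
    mult V S.cls T.cls = Nat.card {k // (U k).cls = T.cls} := by
  classical
  obtain ⟨s⟩ := cls_rep_equiv S
  obtain ⟨t⟩ := cls_rep_equiv T
  let s' : (V.tprod S.cls.rep.ρ).Equiv (V.tprod S.ρ) :=
    Representation.Equiv.mk (TensorProduct.congr (LinearEquiv.refl ℂ W) s.toLinearEquiv) fun g => by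
      ext w x
      have h := IntertwiningMap.isIntertwining _ _ s.toIntertwiningMap g x
      simpa using congrArg (fun y => V g w ⊗ₜ[ℂ] y) h
  rw [mult, finrank_intertwining_congr t (s'.trans e), finrank_intertwining_directSum]
  simp only [finrank_intertwining]
  rw [Finset.sum_boole, Nat.card_eq_fintype_card, Fintype.card_subtype]
  simp [eq_comm]

end multiplicity

/-! ### The skew group algebra `⋀V * Γ` and the Nakayama translation -/

section skew

variable {Γ : Type} [Group Γ] {W : Type} [AddCommGroup W] [Module ℂ W]

/-- The natural action of `Γ` on the exterior algebra `⋀V`. -/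
@[reducible] def extAction (V : Representation ℂ Γ W) :
    MulSemiringAction Γ (ExteriorAlgebra ℂ W) where
  smul g a := ExteriorAlgebra.map (V g) a
  one_smul a := by
    change ExteriorAlgebra.map (V 1) a = a
    rw [map_one]
    exact DFunLike.congr_fun ExteriorAlgebra.map_id a
  mul_smul g h a := by
    change ExteriorAlgebra.map (V (g * h)) a =
      ExteriorAlgebra.map (V g) (ExteriorAlgebra.map (V h) a)
    rw [map_mul]
    exact (DFunLike.congr_fun (ExteriorAlgebra.map_comp_map (V h) (V g)) a).symm
  smul_zero g := map_zero (ExteriorAlgebra.map (V g))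
  smul_add g := map_add (ExteriorAlgebra.map (V g))
  smul_one g := map_one (ExteriorAlgebra.map (V g))
  smul_mul g := map_mul (ExteriorAlgebra.map (V g))

/-- The skew group algebra `⋀V * Γ`: finite formal sums of `a g` with `a ∈ ⋀V` and `g ∈ Γ`,
multiplied by `(a g)(b h) = a g(b) gh`. -/
def SkewGroupAlgebra (_V : Representation ℂ Γ W) : Type :=
  SkewMonoidAlgebra (ExteriorAlgebra ℂ W) Γ

instance (V : Representation ℂ Γ W) : Ring (SkewGroupAlgebra V) :=
  letI := extAction V
  inferInstanceAs (Ring (SkewMonoidAlgebra (ExteriorAlgebra ℂ W) Γ))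

/-- The element `a g` of `⋀V * Γ`. -/
def SkewGroupAlgebra.of (V : Representation ℂ Γ W) (a : ExteriorAlgebra ℂ W) (g : Γ) :
    SkewGroupAlgebra V :=
  SkewMonoidAlgebra.single g a

theorem SkewGroupAlgebra.of_mul_of (V : Representation ℂ Γ W) (a b : ExteriorAlgebra ℂ W)
    (g h : Γ) : of V a g * of V b h = of V (a * ExteriorAlgebra.map (V g) b) (g * h) :=
  letI := extAction V
  SkewMonoidAlgebra.single_mul_single

variable {M : Type} [AddCommGroup M] [Module ℂ M]

/-- The homomorphism from `⋀V * Γ` to `End M` through which `g ∈ Γ` acts by `ρ g` and `V ⊆ ⋀V`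
acts by zero. -/
def inflateHom (V : Representation ℂ Γ W) (ρ : Representation ℂ Γ M) :
    SkewGroupAlgebra V →+* Module.End ℂ M :=
  letI := extAction V
  SkewMonoidAlgebra.liftNCRingHom
    (((algebraMap ℂ (Module.End ℂ M)).comp
      (ExteriorAlgebra.algebraMapInv : ExteriorAlgebra ℂ W →ₐ[ℂ] ℂ).toRingHom)) ρ (by
    intro a g
    have h : (ExteriorAlgebra.algebraMapInv : ExteriorAlgebra ℂ W →ₐ[ℂ] ℂ).comp
        (ExteriorAlgebra.map (V g)) = ExteriorAlgebra.algebraMapInv := by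
      ext w
      simp [ExteriorAlgebra.algebraMapInv]
    have h' := DFunLike.congr_fun h a
    change algebraMap ℂ (Module.End ℂ M) (ExteriorAlgebra.algebraMapInv
      (ExteriorAlgebra.map (V g) a)) * ρ g = ρ g * algebraMap ℂ (Module.End ℂ M) _
    rw [← Algebra.commutes]
    exact congrArg (fun c => algebraMap ℂ (Module.End ℂ M) c * ρ g) h')

theorem inflateHom_of (V : Representation ℂ Γ W) (ρ : Representation ℂ Γ M)
    (a : ExteriorAlgebra ℂ W) (g : Γ) (x : M) :
    inflateHom V ρ (.of V a g) x = ExteriorAlgebra.algebraMapInv a • ρ g x := by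
  let _ := extAction V
  exact DFunLike.congr_fun (SkewMonoidAlgebra.liftNC_single
    (((algebraMap ℂ (Module.End ℂ M)).comp
      (ExteriorAlgebra.algebraMapInv : ExteriorAlgebra ℂ W →ₐ[ℂ] ℂ).toRingHom) : _ →+ _)
    ρ g a) x

/-- A representation `ρ` of `Γ` as a module over `⋀V * Γ`, on which `V ⊆ ⋀V` acts by zero. For
`ρ` irreducible this is the simple `⋀V * Γ`-module associated to the vertex `[ρ]`. -/
def Inflation (_V : Representation ℂ Γ W) (_ρ : Representation ℂ Γ M) : Type := M

instance (V : Representation ℂ Γ W) (ρ : Representation ℂ Γ M) : AddCommGroup (Inflation V ρ) :=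
  inferInstanceAs (AddCommGroup M)

instance (V : Representation ℂ Γ W) (ρ : Representation ℂ Γ M) :
    Module (SkewGroupAlgebra V) (Inflation V ρ) :=
  Module.compHom M (inflateHom V ρ)

/-- `π : P → N` is a projective cover: `P` is projective, `π` is surjective, and its kernel is a
superfluous submodule of `P`. -/
structure IsProjectiveCover {A : Type} [Ring A] {P N : Type} [AddCommGroup P] [Module A P]
    [AddCommGroup N] [Module A N] (π : P →ₗ[A] N) : Prop where
  projective : Module.Projective A P
  surjective : Function.Surjective π
  superfluous : ∀ K : Submodule A P, K ⊔ LinearMap.ker π = ⊤ → K = ⊤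

/-- The socle of a module: the sum of its simple submodules. -/
def socle (A : Type) [Ring A] (P : Type) [AddCommGroup P] [Module A P] : Submodule A P :=
  sSup {K : Submodule A P | IsSimpleModule A K}

/-- `σ` is the Nakayama translation on the vertices of the McKay quiver of `(Γ, V)`: for every
vertex `i`, the socle of the projective cover over `⋀V * Γ` of the simple module associated to `i`
is the simple module associated to `σ i`. -/
def IsNakayamaTranslation (V : Representation ℂ Γ W) (σ : Equiv.Perm (IrrClass Γ)) : Prop :=
  ∀ i : IrrClass Γ, ∃ (P : Type) (_ : AddCommGroup P) (_ : Module (SkewGroupAlgebra V) P)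
    (π : P →ₗ[SkewGroupAlgebra V] Inflation V i.rep.ρ),
    IsProjectiveCover π ∧
      Nonempty (socle (SkewGroupAlgebra V) P ≃ₗ[SkewGroupAlgebra V] Inflation V (σ i).rep.ρ)

end skew

end McKay

end

/-! A finite abelian group acting on `ℂ^(n + 1)` has, by Maschke and Schur, an invariant line with
an invariant complement (`exists_invariant_line`). In a basis adapted to this splitting and scaled
to determinant one, `G` is block diagonal, and determinant one forces the last entry to be the
inverse determinant of the other block (`exists_conj_mem_range_detEmbedding`). So `G'` can be the
preimage of `G`, and the natural representation `V` of `G` becomes `V' ⊕ det(V')⁻¹` over `G'`.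

The groups being abelian, vertices are characters, and the number of arrows `χ → ψ` is the
multiplicity of the weight `ψχ⁻¹` (`mult_charClass`). Weight multiplicities are additive, so the
summand `det(V')⁻¹` contributes one extra arrow exactly when `χ = ψ det(V')`.

It remains to see that the Nakayama translation is `ψ ↦ ψ det(V')`. The projective cover of `χ` is
`⋀V' ⊗ χ`, a direct summand of the skew group algebra in which every element with nonzero constant
term generates everything. Every nonzero element of `⋀V'` has the top form as a left multiple
(`exists_mul_eq_ιMulti_basis`), so the line of the top form is the unique minimal submodule, hence
the socle, and the group acts on it by `χ det(V')`. -/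

namespace ExteriorAlgebra

/-! ### Exterior algebras: the top form and elements with nonzero constant term -/

section CommRing

variable {R M : Type*} [CommRing R] [AddCommGroup M] [Module R M]

@[simp]
theorem algebraMapInv_ι (m : M) : algebraMapInv (ι R m) = 0 := by
  simp [algebraMapInv]

theorem algebraMapInv_map {N : Type*} [AddCommGroup N] [Module R N] (f : M →ₗ[R] N)
    (a : ExteriorAlgebra R M) : algebraMapInv (map f a) = algebraMapInv a := by
  have h : (algebraMapInv : ExteriorAlgebra R N →ₐ[R] R).comp (map f) = algebraMapInv := by
    ext m
    simp
  exact DFunLike.congr_fun h a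

/-- An element killed on the left by distinct members of a basis is a left multiple of their
product. -/
theorem exists_eq_prod_mul {I : Type*} (b : Module.Basis I R M) (l : List I) (hl : l.Nodup)
    (x : ExteriorAlgebra R M) (hx : ∀ i ∈ l, ι R (b i) * x = 0) :
    ∃ y, x = (l.map fun i => ι R (b i)).prod * y := by
  classical
  induction l generalizing x with
  | nil => exact ⟨x, by simp⟩
  | cons a l ih =>
    obtain ⟨hal, hl⟩ := List.nodup_cons.1 hl
    -- Contraction `d` with the dual vector of `b a` is an antiderivation. For `i ≠ a` it shows that
    -- `b i` kills `d x` as well, so the induction hypothesis applies to `d x`; for `i = a` it gives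
    -- `x = b a * d x`.
    have key : ∀ i, CliffordAlgebra.contractLeft (Q := (0 : QuadraticForm R M)) (b.coord a)
        (ι R (b i) * x) = b.coord a (b i) • x - ι R (b i) *
          CliffordAlgebra.contractLeft (Q := (0 : QuadraticForm R M)) (b.coord a) x :=
      fun i => CliffordAlgebra.contractLeft_ι_mul _ _ _
    obtain ⟨y, hy⟩ := ih hl (CliffordAlgebra.contractLeft (Q := (0 : QuadraticForm R M))
      (b.coord a) x) fun i hi => by
        have h := key i
        have hia : i ≠ a := fun h => hal (h ▸ hi)
        rw [hx i (List.mem_cons_of_mem _ hi), map_zero] at h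
        simpa [hia] using h
    refine ⟨y, ?_⟩
    have h := key a
    rw [hx a List.mem_cons_self, map_zero] at h
    rw [List.map_cons, List.prod_cons, mul_assoc, ← hy]
    simpa [sub_eq_zero] using h.symm

end CommRing

variable {K W : Type*} [Field K] [AddCommGroup W] [Module K W] {n : ℕ}
  (e : Module.Basis (Fin n) K W)

theorem ιMulti_eq_zero_of_basis (e : Module.Basis (Fin n) K W) (v : Fin (n + 1) → W) :
    ιMulti K (n + 1) v = 0 := by
  refine AlternatingMap.map_linearDependent _ _ fun h => ?_
  have : Module.Finite K W := .of_basis e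
  have := h.fintype_card_le_finrank
  rw [Module.finrank_eq_card_basis e] at this
  simp at this

/-- A vector times the top form is a wedge of `n + 1` vectors in dimension `n`, so it vanishes; only
the constant term of `a` survives. -/
theorem mul_ιMulti_basis (a : ExteriorAlgebra K W) :
    a * ιMulti K n e = algebraMapInv a • ιMulti K n e := by
  induction a using ExteriorAlgebra.induction with
  | algebraMap r => simp [← Algebra.smul_def, algebraMap_leftInverse W r]
  | ι w =>
    have h := ιMulti_eq_zero_of_basis e (Fin.cons w e)
    rw [ιMulti_succ_apply] at h
    simpa [Matrix.vecTail, Function.comp_def] using h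
  | mul a b ha hb => rw [mul_assoc, hb, mul_smul_comm, ha, smul_smul, map_mul, mul_comm]
  | add a b ha hb => rw [add_mul, ha, hb, map_add, add_smul]

theorem ιMulti_basis_mul (a : ExteriorAlgebra K W) :
    ιMulti K n e * a = algebraMapInv a • ιMulti K n e := by
  induction a using ExteriorAlgebra.induction with
  | algebraMap r =>
    rw [← Algebra.commutes, ← Algebra.smul_def, algebraMap_leftInverse W r]
  | ι w =>
    have h := ιMulti_eq_zero_of_basis e (Fin.append e ![w])
    rw [← ιMulti_mul_ιMulti] at h
    simpa using h
  | mul a b ha hb => rw [← mul_assoc, ha, smul_mul_assoc, hb, smul_smul, map_mul]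
  | add a b ha hb => rw [mul_add, ha, hb, map_add, add_smul]

theorem ιMulti_basis_ne_zero : ιMulti K n e ≠ 0 := by
  intro h
  have h' := congrArg (liftAlternating (R := K) (M := W) (N := K)
    -- The linear functional equal to the determinant in degree `n` and zero in other degrees takes
    -- the value 1 on the top form.
    (Pi.single n e.det)) h
  rw [liftAlternating_apply_ιMulti] at h'
  have h1 := e.det_self
  simp at h'
  simp [h'] at h1

theorem ιMulti_eq_det_smul (v : Fin n → W) : ιMulti K n v = e.det v • ιMulti K n e := by
  let f : W [⋀^Fin n]→ₗ[K] ExteriorAlgebra K W :=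
    (LinearMap.toSpanSingleton K _ (ιMulti K n e)).compAlternatingMap e.det
  have h : ιMulti K n = f := by
    refine Module.Basis.ext_alternating e fun v hv => ?_
    obtain ⟨s, rfl⟩ : ∃ s : Equiv.Perm (Fin n), v = s :=
      ⟨Equiv.ofBijective v (Finite.injective_iff_bijective.1 hv), rfl⟩
    change ιMulti K n (e ∘ s) = f (e ∘ s)
    rw [AlternatingMap.map_perm, AlternatingMap.map_perm]
    simp [f, e.det_self]
  exact DFunLike.congr_fun h v

theorem map_ιMulti_basis (f : W →ₗ[K] W) :
    map f (ιMulti K n e) = LinearMap.det f • ιMulti K n e := by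
  rw [map_apply_ιMulti, ιMulti_eq_det_smul e, e.det_comp, e.det_self, mul_one]

/-- Every nonzero element of the exterior algebra has the top form as a left multiple. -/
theorem exists_mul_eq_ιMulti_basis {x : ExteriorAlgebra K W} (hx : x ≠ 0) :
    ∃ a, a * x = ιMulti K n e := by
  -- Multiply by one basis vector after another, skipping those that would give zero. Vectors that
  -- already kill the product still do so afterwards, by anticommutation.
  have key : ∀ s : Finset (Fin n), ∃ a, a * x ≠ 0 ∧ ∀ i ∈ s, ι K (e i) * (a * x) = 0 := by
    intro s
    induction s using Finset.induction_on with
    | empty => exact ⟨1, by simpa using hx, by simp⟩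
    | insert j s _ ih =>
      obtain ⟨a, ha, has⟩ := ih
      by_cases hj : ι K (e j) * (a * x) = 0
      · exact ⟨a, ha, fun i hi => (Finset.mem_insert.1 hi).elim (fun h => h ▸ hj) (has i)⟩
      · refine ⟨ι K (e j) * a, by rwa [mul_assoc], fun i hi => ?_⟩
        rw [mul_assoc (ι K (e j)), ← mul_assoc]
        rcases Finset.mem_insert.1 hi with rfl | hi
        · rw [ι_sq_zero, zero_mul]
        · rw [eq_neg_of_add_eq_zero_left (ι_add_mul_swap (e i) (e j)), neg_mul, mul_assoc,
            has i hi, mul_zero, neg_zero]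
  obtain ⟨a, ha, hk⟩ := key Finset.univ
  obtain ⟨y, hy⟩ := exists_eq_prod_mul e (List.finRange n) (List.nodup_finRange n) (a * x)
    fun i _ => hk i (Finset.mem_univ i)
  rw [List.finRange, List.map_ofFn] at hy
  change a * x = ιMulti K n e * y at hy
  -- The product is a right multiple of the top form, hence a scalar multiple, and the scalar is
  -- nonzero because `a * x` is.
  rw [ιMulti_basis_mul] at hy
  have hy0 : algebraMapInv y ≠ 0 := fun h => ha (by rw [hy, h, zero_smul])
  exact ⟨(algebraMapInv y)⁻¹ • a, by rw [smul_mul_assoc, hy, smul_smul, inv_mul_cancel₀ hy0,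
    one_smul]⟩

/-- An element of the exterior algebra with nonzero constant term is left invertible. -/
theorem exists_mul_eq_one_of_algebraMapInv_ne_zero [FiniteDimensional K W]
    {x : ExteriorAlgebra K W} (hx : algebraMapInv x ≠ 0) : ∃ a, a * x = 1 := by
  let e := Module.finBasis K W
  have : FiniteDimensional K (ExteriorAlgebra K W) := .of_basis e.ExteriorAlgebra
  -- If `a * x = 0` with `a ≠ 0`, choose `b` with `b * a` the top form; then the top form times `x`
  -- is zero, yet it is the constant term of `x` times the top form.
  have hinj : Function.Injective (LinearMap.mulRight K x) := by
    rw [injective_iff_map_eq_zero]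
    intro a ha
    by_contra ha0
    obtain ⟨b, hb⟩ := exists_mul_eq_ιMulti_basis e ha0
    have h := ιMulti_basis_mul e x
    rw [← hb, mul_assoc, show a * x = 0 from ha, mul_zero, hb, eq_comm, smul_eq_zero] at h
    exact h.elim hx (ιMulti_basis_ne_zero e)
  exact LinearMap.injective_iff_surjective.1 hinj 1

end ExteriorAlgebra

noncomputable section

namespace McKay

/-! ### Characters as one-dimensional representations -/

section characters

variable {Γ : Type} [Group Γ]

/-- The one-dimensional representation on `ℂ` given by a character. -/
def charRep (χ : Γ →* ℂˣ) : Representation ℂ Γ ℂ :=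
  (Algebra.lmul ℂ ℂ : ℂ →* Module.End ℂ ℂ).comp ((Units.coeHom ℂ).comp χ)

@[simp]
theorem charRep_apply (χ : Γ →* ℂˣ) (g : Γ) (z : ℂ) : charRep χ g z = χ g * z := rfl

theorem equiv_charRep_apply {χ : Γ →* ℂˣ} {M : Type} [AddCommGroup M] [Module ℂ M]
    {ρ : Representation ℂ Γ M} (e : (charRep χ).Equiv ρ) (g : Γ) (x : M) :
    ρ g x = (χ g : ℂ) • x := by
  obtain ⟨z, rfl⟩ := e.toLinearEquiv.surjective x
  have h := e.toIntertwiningMap.isIntertwining _ _ g z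
  rw [← map_smul]
  exact h.symm

end characters

/-! ### The modules `⋀V ⊗ χ`: projectivity, head and socle -/

section skew

variable {Γ : Type} [Group Γ] {W : Type} [AddCommGroup W] [Module ℂ W]
  (V : Representation ℂ Γ W)

namespace SkewGroupAlgebra

variable {V}

theorem of_add (a b : ExteriorAlgebra ℂ W) (g : Γ) : of V (a + b) g = of V a g + of V b g :=
  SkewMonoidAlgebra.single_add _ _ _

theorem of_zero (g : Γ) : of V 0 g = 0 :=
  SkewMonoidAlgebra.single_zero _

theorem induction_on {p : SkewGroupAlgebra V → Prop} (r : SkewGroupAlgebra V)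
    (of : ∀ a g, p (of V a g)) (add : ∀ r s, p r → p s → p (r + s)) : p r :=
  SkewMonoidAlgebra.induction_on (p := p) r (of_zero (V := V) (1 : Γ) ▸ of 0 1)
    (fun g a => of a g) (fun {r s} => add r s)

/-- An additive map that commutes with the elements `a g` is linear over `⋀V * Γ`. -/
def linearMapOfAdd {M N : Type} [AddCommGroup M] [Module (SkewGroupAlgebra V) M]
    [AddCommGroup N] [Module (SkewGroupAlgebra V) N] (f : M →+ N)
    (hf : ∀ a g x, f (of V a g • x) = of V a g • f x) : M →ₗ[SkewGroupAlgebra V] N where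
  toFun := f
  map_add' := f.map_add
  map_smul' r x := by
    refine induction_on (p := fun r => f (r • x) = r • f x) r (fun a g => hf a g x) ?_
    intro r s hr hs
    rw [add_smul, map_add, hr, hs, add_smul]

end SkewGroupAlgebra

open SkewGroupAlgebra

/-- The homomorphism `⋀V * Γ → End ⋀V` through which `⋀V` acts by left multiplication and `g ∈ Γ`
by its natural action multiplied by `χ g`. -/
def extHom (χ : Γ →* ℂˣ) : SkewGroupAlgebra V →+* Module.End ℂ (ExteriorAlgebra ℂ W) :=
  letI := extAction V
  SkewMonoidAlgebra.liftNCRingHom (Algebra.lmul ℂ (ExteriorAlgebra ℂ W)).toRingHom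
    ({ toFun := fun g => (χ g : ℂ) • (ExteriorAlgebra.map (V g)).toLinearMap
       map_one' := by
        ext x
        simp
       map_mul' := fun g h => by
        refine LinearMap.ext fun x => ?_
        have := DFunLike.congr_fun (ExteriorAlgebra.map_comp_map (V h) (V g)) x
        rw [AlgHom.comp_apply, ← Module.End.mul_eq_comp] at this
        simp [smul_smul, mul_comm, this] } :
      Γ →* Module.End ℂ (ExteriorAlgebra ℂ W)) (by
    intro a g
    refine LinearMap.ext fun x => ?_
    change ExteriorAlgebra.map (V g) a * ((χ g : ℂ) • ExteriorAlgebra.map (V g) x) =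
      (χ g : ℂ) • ExteriorAlgebra.map (V g) (a * x)
    rw [map_mul, mul_smul_comm])

theorem extHom_of (χ : Γ →* ℂˣ) (a x : ExteriorAlgebra ℂ W) (g : Γ) :
    extHom V χ (of V a g) x = (χ g : ℂ) • (a * ExteriorAlgebra.map (V g) x) := by
  let _ := extAction V
  refine (DFunLike.congr_fun (SkewMonoidAlgebra.liftNC_single
    ((Algebra.lmul ℂ (ExteriorAlgebra ℂ W)).toRingHom :
      ExteriorAlgebra ℂ W →+ Module.End ℂ (ExteriorAlgebra ℂ W)) _ g a) x).trans ?_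
  exact mul_smul_comm (χ g : ℂ) a (ExteriorAlgebra.map (V g) x)

/-- The module `⋀V ⊗ χ` over `⋀V * Γ`. -/
def ExtModule (_V : Representation ℂ Γ W) (_χ : Γ →* ℂˣ) : Type := ExteriorAlgebra ℂ W

instance (χ : Γ →* ℂˣ) : AddCommGroup (ExtModule V χ) :=
  inferInstanceAs (AddCommGroup (ExteriorAlgebra ℂ W))

instance (χ : Γ →* ℂˣ) : Module (SkewGroupAlgebra V) (ExtModule V χ) :=
  Module.compHom (ExteriorAlgebra ℂ W) (extHom V χ)

/-- The element of the inflation of `ρ` given by a vector. -/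
def Inflation.mk {M : Type} [AddCommGroup M] [Module ℂ M] (V : Representation ℂ Γ W)
    (ρ : Representation ℂ Γ M) : M ≃+ Inflation V ρ := AddEquiv.refl _

theorem Inflation.of_smul_mk {M : Type} [AddCommGroup M] [Module ℂ M]
    (ρ : Representation ℂ Γ M) (a : ExteriorAlgebra ℂ W) (g : Γ) (x : M) :
    of V a g • mk V ρ x = mk V ρ (ExteriorAlgebra.algebraMapInv a • ρ g x) :=
  inflateHom_of V ρ a g x

/-- The element of `⋀V ⊗ χ` given by an element of `⋀V`. -/
def ExtModule.mk (χ : Γ →* ℂˣ) : ExteriorAlgebra ℂ W ≃+ ExtModule V χ := AddEquiv.refl _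

variable {V} {χ : Γ →* ℂˣ}

namespace ExtModule

theorem of_smul_mk (a x : ExteriorAlgebra ℂ W) (g : Γ) :
    of V a g • mk V χ x = mk V χ ((χ g : ℂ) • (a * ExteriorAlgebra.map (V g) x)) :=
  extHom_of V χ a x g

theorem of_one_smul_mk (a x : ExteriorAlgebra ℂ W) :
    of V a 1 • mk V χ x = mk V χ (a * x) := by
  rw [of_smul_mk, map_one, map_one, Units.val_one, one_smul]
  exact congrArg (fun y => mk V χ (a * y)) (DFunLike.congr_fun ExteriorAlgebra.map_id x)

theorem mul_mem (K : Submodule (SkewGroupAlgebra V) (ExtModule V χ)) (a : ExteriorAlgebra ℂ W)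
    {x : ExteriorAlgebra ℂ W} (hx : mk V χ x ∈ K) : mk V χ (a * x) ∈ K := by
  rw [← of_one_smul_mk]
  exact K.smul_mem _ hx

theorem smul_mem (K : Submodule (SkewGroupAlgebra V) (ExtModule V χ)) (c : ℂ)
    {x : ExteriorAlgebra ℂ W} (hx : mk V χ x ∈ K) : mk V χ (c • x) ∈ K := by
  rw [Algebra.smul_def]
  exact mul_mem K _ hx

/-- With the idempotent `e_χ = |Γ|⁻¹ ∑ χ(g⁻¹) g`, the map `x ↦ x e_χ` is a section of `r ↦ r • 1`,
which makes `⋀V ⊗ χ` a direct summand of the regular module. -/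
theorem projective [Finite Γ] : Module.Projective (SkewGroupAlgebra V) (ExtModule V χ) := by
  have := Fintype.ofFinite Γ
  have hc : (Fintype.card Γ : ℂ) ≠ 0 := Nat.cast_ne_zero.2 Fintype.card_ne_zero
  let c : ℂ := (Fintype.card Γ : ℂ)⁻¹
  let p : SkewGroupAlgebra V →ₗ[SkewGroupAlgebra V] ExtModule V χ :=
    LinearMap.toSpanSingleton _ _ (mk V χ 1)
  let i : ExtModule V χ →ₗ[SkewGroupAlgebra V] SkewGroupAlgebra V :=
    linearMapOfAdd
      { toFun := fun x => ∑ g : Γ, of V ((c * (χ g⁻¹ : ℂ)) • (mk V χ).symm x) g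
        map_zero' := by simp [of_zero]
        map_add' := fun x y => by
          simp [of_add, Finset.sum_add_distrib] }
      (by
        intro a g x
        obtain ⟨x, rfl⟩ := (mk V χ).surjective x
        rw [of_smul_mk]
        simp only [AddMonoidHom.coe_mk, ZeroHom.coe_mk, AddEquiv.symm_apply_apply, smul_eq_mul,
          Finset.mul_sum, of_mul_of]
        refine Fintype.sum_equiv (Equiv.mulLeft g⁻¹) _ _ fun h => ?_
        simp only [Equiv.coe_mulLeft, mul_inv_cancel_left, map_smul, mul_smul_comm, smul_smul]
        congr 2
        simp [mul_assoc])
  refine Module.Projective.of_split i p ?_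
  ext x
  obtain ⟨x, rfl⟩ := (mk V χ).surjective x
  change (∑ g : Γ, of V ((c * (χ g⁻¹ : ℂ)) • x) g) • mk V χ 1 = mk V χ x
  have h : ∀ g : Γ, of V ((c * (χ g⁻¹ : ℂ)) • x) g • mk V χ 1 = mk V χ (c • x) := by
    intro g
    rw [of_smul_mk, map_one, mul_one, smul_smul]
    congr 2
    rw [mul_left_comm, ← Units.val_mul, ← map_mul, mul_inv_cancel, map_one, Units.val_one, mul_one]
  rw [Finset.sum_smul, Finset.sum_congr rfl fun g _ => h g, ← map_sum, Finset.sum_const,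
    Finset.card_univ, ← Nat.cast_smul_eq_nsmul ℂ, smul_smul, mul_inv_cancel₀ hc, one_smul]

variable {M : Type} [AddCommGroup M] [Module ℂ M] {ρ : Representation ℂ Γ M}

/-- The projection of `⋀V ⊗ χ` to its head. -/
def proj (V : Representation ℂ Γ W) (e : (charRep χ).Equiv ρ) :
    ExtModule V χ →ₗ[SkewGroupAlgebra V] Inflation V ρ :=
  linearMapOfAdd ((Inflation.mk V ρ).toAddMonoidHom.comp
    (e.toLinearEquiv.toAddMonoidHom.comp
      ((ExteriorAlgebra.algebraMapInv : ExteriorAlgebra ℂ W →ₐ[ℂ] ℂ).toRingHom.toAddMonoidHom.comp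
        (mk V χ).symm.toAddMonoidHom))) (by
    intro a g x
    obtain ⟨x, rfl⟩ := (mk V χ).surjective x
    rw [of_smul_mk]
    change Inflation.mk V ρ (e.toLinearEquiv (ExteriorAlgebra.algebraMapInv
      ((χ g : ℂ) • (a * ExteriorAlgebra.map (V g) x)))) =
      of V a g • Inflation.mk V ρ (e.toLinearEquiv (ExteriorAlgebra.algebraMapInv x))
    rw [Inflation.of_smul_mk, equiv_charRep_apply e, map_smul, map_mul,
      ExteriorAlgebra.algebraMapInv_map, ← map_smul, ← map_smul]
    congr 2
    simp only [smul_eq_mul]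
    ring)

theorem proj_mk (e : (charRep χ).Equiv ρ) (x : ExteriorAlgebra ℂ W) :
    proj V e (mk V χ x) =
      Inflation.mk V ρ (e.toLinearEquiv (ExteriorAlgebra.algebraMapInv x)) := rfl

theorem isProjectiveCover_proj [Finite Γ] [FiniteDimensional ℂ W] (e : (charRep χ).Equiv ρ) :
    IsProjectiveCover (proj V e) where
  projective := projective
  surjective y := by
    obtain ⟨y, rfl⟩ := (Inflation.mk V ρ).surjective y
    obtain ⟨z, hz⟩ := e.toLinearEquiv.surjective y
    refine ⟨mk V χ (algebraMap ℂ _ z), ?_⟩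
    rw [proj_mk, ExteriorAlgebra.algebraMap_leftInverse W z, hz]
  superfluous K hK := by
    have h1 : mk V χ 1 ∈ K ⊔ LinearMap.ker (proj V e) := hK ▸ Submodule.mem_top
    obtain ⟨x, hx, y, hy, hxy⟩ := Submodule.mem_sup.1 h1
    obtain ⟨x, rfl⟩ := (mk V χ).surjective x
    obtain ⟨y, rfl⟩ := (mk V χ).surjective y
    rw [← map_add, (mk V χ).apply_eq_iff_eq] at hxy
    have hy0 : ExteriorAlgebra.algebraMapInv y = 0 :=
      (LinearEquiv.map_eq_zero_iff e.toLinearEquiv).1 hy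
    have hx1 : ExteriorAlgebra.algebraMapInv x = 1 := by
      have := congrArg ExteriorAlgebra.algebraMapInv hxy
      -- The kernel consists of elements without constant term, so `x ∈ K` has constant term 1;
      -- being left invertible, it generates the whole module.
      rwa [map_add, hy0, add_zero, map_one] at this
    obtain ⟨a, ha⟩ := ExteriorAlgebra.exists_mul_eq_one_of_algebraMapInv_ne_zero
      (hx1 ▸ one_ne_zero)
    refine (Submodule.eq_top_iff').2 fun z => ?_
    obtain ⟨z, rfl⟩ := (mk V χ).surjective z
    have h := mul_mem K (z * a) hx
    rwa [mul_assoc, ha, mul_one] at h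

/-- The determinant character of a finite-dimensional representation. -/
def _root_.McKay.detChar (V : Representation ℂ Γ W) : Γ →* ℂˣ :=
  (LinearMap.det.comp V : Γ →* ℂ).toHomUnits

@[simp]
theorem _root_.McKay.detChar_apply (g : Γ) : (detChar V g : ℂ) = LinearMap.det (V g) := rfl

/-- The embedding of the top exterior power, twisted by `χ`, in `⋀V ⊗ χ`. -/
def top {n : ℕ} (b : Module.Basis (Fin n) ℂ W) (e : (charRep (χ * detChar V)).Equiv ρ) :
    Inflation V ρ →ₗ[SkewGroupAlgebra V] ExtModule V χ :=
  linearMapOfAdd ((mk V χ).toAddMonoidHom.comp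
    ((LinearMap.toSpanSingleton ℂ _ (ExteriorAlgebra.ιMulti ℂ n b)).toAddMonoidHom.comp
      (e.toLinearEquiv.symm.toAddMonoidHom.comp (Inflation.mk V ρ).symm.toAddMonoidHom))) (by
    intro a g x
    obtain ⟨x, rfl⟩ := (Inflation.mk V ρ).surjective x
    rw [Inflation.of_smul_mk, equiv_charRep_apply e]
    change mk V χ (e.toLinearEquiv.symm (ExteriorAlgebra.algebraMapInv a •
        (((χ * detChar V) g : ℂˣ) : ℂ) • x) • ExteriorAlgebra.ιMulti ℂ n b) =
      of V a g • mk V χ (e.toLinearEquiv.symm x • ExteriorAlgebra.ιMulti ℂ n b)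
    rw [of_smul_mk, map_smul e.toLinearEquiv.symm, map_smul e.toLinearEquiv.symm,
      map_smul (ExteriorAlgebra.map (V g)), ExteriorAlgebra.map_ιMulti_basis,
      mul_smul_comm, mul_smul_comm, ExteriorAlgebra.mul_ιMulti_basis, smul_smul, smul_smul,
      smul_smul, smul_smul]
    congr 2
    simp only [smul_eq_mul, MonoidHom.mul_apply, Units.val_mul, detChar_apply]
    ring)

theorem top_apply {n : ℕ} (b : Module.Basis (Fin n) ℂ W)
    (e : (charRep (χ * detChar V)).Equiv ρ) (x : M) :
    top b e (Inflation.mk V ρ x) =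
      mk V χ (e.toLinearEquiv.symm x • ExteriorAlgebra.ιMulti ℂ n b) := rfl

theorem top_injective {n : ℕ} (b : Module.Basis (Fin n) ℂ W)
    (e : (charRep (χ * detChar V)).Equiv ρ) : Function.Injective (top b e) := by
  rw [injective_iff_map_eq_zero]
  intro x hx
  obtain ⟨x, rfl⟩ := (Inflation.mk V ρ).surjective x
  rw [top_apply, (mk V χ).map_eq_zero_iff, smul_eq_zero] at hx
  rw [(LinearEquiv.map_eq_zero_iff e.toLinearEquiv.symm).1
    (hx.resolve_right (ExteriorAlgebra.ιMulti_basis_ne_zero b)), map_zero]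

theorem range_top_le {n : ℕ} (b : Module.Basis (Fin n) ℂ W)
    (e : (charRep (χ * detChar V)).Equiv ρ) (K : Submodule (SkewGroupAlgebra V) (ExtModule V χ))
    (hK : K ≠ ⊥) : LinearMap.range (top b e) ≤ K := by
  obtain ⟨x, hx, hx0⟩ := Submodule.exists_mem_ne_zero_of_ne_bot hK
  obtain ⟨x, rfl⟩ := (mk V χ).surjective x
  obtain ⟨a, ha⟩ := ExteriorAlgebra.exists_mul_eq_ιMulti_basis b
    fun h => hx0 ((mk V χ).map_eq_zero_iff.2 h)
  rintro _ ⟨y, rfl⟩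
  obtain ⟨y, rfl⟩ := (Inflation.mk V ρ).surjective y
  rw [top_apply, ← ha]
  exact smul_mem K _ (mul_mem K _ hx)

theorem range_top_ne_bot {n : ℕ} (b : Module.Basis (Fin n) ℂ W)
    (e : (charRep (χ * detChar V)).Equiv ρ) : LinearMap.range (top b e) ≠ ⊥ := by
  intro h
  have h1 : top b e (Inflation.mk V ρ (e.toLinearEquiv 1)) = 0 :=
    LinearMap.range_eq_bot.1 h ▸ rfl
  have h2 := (map_eq_zero_iff _ (top_injective b e)).1 h1
  rw [(Inflation.mk V ρ).map_eq_zero_iff] at h2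
  exact one_ne_zero ((LinearEquiv.map_eq_zero_iff e.toLinearEquiv).1 h2)

/-- The line of the top form lies in every nonzero submodule, so it is the only simple one. -/
theorem socle_eq_range_top {n : ℕ} (b : Module.Basis (Fin n) ℂ W)
    (e : (charRep (χ * detChar V)).Equiv ρ) :
    socle (SkewGroupAlgebra V) (ExtModule V χ) = LinearMap.range (top b e) := by
  have hatom : IsAtom (LinearMap.range (top b e)) :=
    ⟨range_top_ne_bot b e, fun K hK => by
      by_contra h
      exact hK.not_ge (range_top_le b e K h)⟩
  refine le_antisymm (sSup_le fun K hK => ?_) (le_sSup (isSimpleModule_iff_isAtom.2 hatom))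
  have hK : IsAtom K := isSimpleModule_iff_isAtom.1 hK
  rw [(hK.le_iff_eq hatom.1).1 (range_top_le b e K hK.1)]

theorem nonempty_socle_equiv [FiniteDimensional ℂ W] (e : (charRep (χ * detChar V)).Equiv ρ) :
    Nonempty (socle (SkewGroupAlgebra V) (ExtModule V χ) ≃ₗ[SkewGroupAlgebra V]
      Inflation V ρ) := by
  let b := Module.finBasis ℂ W
  rw [socle_eq_range_top b e]
  exact ⟨(LinearEquiv.ofInjective (top b e) (top_injective b e)).symm⟩

end ExtModule

end skew

open Representation

/-! ### Irreducible representations of finite abelian groups are characters -/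

section classes

variable {Γ : Type} [Group Γ]

theorem isIrreducible_charRep (χ : Γ →* ℂˣ) : (charRep χ).IsIrreducible := by
  have hinj := Subrepresentation.toSubmodule_injective (ρ := charRep χ)
  have hsimple : IsSimpleOrder (Submodule ℂ ℂ) := inferInstance
  refine { exists_pair_ne := ⟨⊥, ⊤, fun h => ?_⟩, eq_bot_or_eq_top := fun K => ?_ }
  · exact bot_ne_top (α := Submodule ℂ ℂ) (congrArg Subrepresentation.toSubmodule h)
  · exact (eq_bot_or_eq_top K.toSubmodule).imp (fun h => hinj h) (fun h => hinj h)

/-- A character as an irreducible representation. -/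
def charIrrep (χ : Γ →* ℂˣ) : Irrep Γ where
  carrier := ℂ
  ρ := charRep χ
  irreducible := isIrreducible_charRep χ

theorem charRep_equiv_iff {χ ψ : Γ →* ℂˣ} :
    Nonempty ((charRep χ).Equiv (charRep ψ)) ↔ χ = ψ := by
  refine ⟨fun ⟨e⟩ => ?_, fun h => h ▸ ⟨.refl _⟩⟩
  ext g
  simpa using (equiv_charRep_apply e g 1).symm

/-- A one-dimensional representation is given by a character. -/
theorem exists_charRep_equiv {M : Type} [AddCommGroup M] [Module ℂ M]
    (ρ : Representation ℂ Γ M) (h : Module.finrank ℂ M = 1) :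
    ∃ χ : Γ →* ℂˣ, Nonempty ((charRep χ).Equiv ρ) := by
  have : FiniteDimensional ℂ M := .of_finrank_pos (h ▸ one_pos)
  let e : ℂ ≃ₗ[ℂ] M := LinearEquiv.ofFinrankEq ℂ M (by simp [h])
  refine ⟨detChar ρ, ⟨.mk e fun g => ?_⟩⟩
  -- On a line the determinant of an endomorphism is the scalar by which it acts.
  have h1 : LinearMap.det (ρ g) = e.symm (ρ g (e 1)) := by
    rw [← LinearMap.det_conj (ρ g) e.symm, LinearMap.det_ring]
    rfl
  ext
  simp [h1]

/-- For a commutative group, the irreducible representations are the characters. -/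
def charClass [Finite Γ] [IsMulCommutative Γ] : (Γ →* ℂˣ) ≃ IrrClass Γ :=
  Equiv.ofBijective (fun χ => (charIrrep χ).cls)
    ⟨fun _ _ h => charRep_equiv_iff.1 (Quotient.exact h), fun i => by
      induction i using Quotient.inductionOn with
      | h S =>
        obtain ⟨χ, h⟩ := exists_charRep_equiv S.ρ
          (IsIrreducible.finrank_eq_one_of_isMulCommutative S.ρ)
        exact ⟨χ, Quotient.sound h⟩⟩

theorem charRep_equiv_rep [Finite Γ] [IsMulCommutative Γ] (χ : Γ →* ℂˣ) :
    Nonempty ((charRep χ).Equiv (charClass χ).rep.ρ) :=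
  (cls_rep_equiv (charIrrep χ)).map .symm

end classes

/-! ### Arrows of the McKay quiver as weight multiplicities -/

section weights

variable {Γ : Type} [Group Γ] {W : Type} [AddCommGroup W] [Module ℂ W]

/-- The vectors on which the group acts through a character. -/
def weightSpace (V : Representation ℂ Γ W) (θ : Γ →* ℂˣ) : Submodule ℂ W where
  carrier := {v | ∀ g, V g v = (θ g : ℂ) • v}
  add_mem' hx hy g := by rw [map_add, hx g, hy g, smul_add]
  zero_mem' g := by simp
  smul_mem' c x hx g := by rw [map_smul, hx g, smul_comm]

theorem mem_weightSpace {V : Representation ℂ Γ W} {θ : Γ →* ℂˣ} {v : W} :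
    v ∈ weightSpace V θ ↔ ∀ g, V g v = (θ g : ℂ) • v := Iff.rfl

theorem rid_tprod_charRep (V : Representation ℂ Γ W) (χ : Γ →* ℂˣ) (g : Γ) (t : W ⊗[ℂ] ℂ) :
    TensorProduct.rid ℂ W (V.tprod (charRep χ) g t) =
      (χ g : ℂ) • V g (TensorProduct.rid ℂ W t) := by
  induction t with
  | zero => simp
  | add s t hs ht => rw [map_add, map_add, hs, ht, map_add, map_add, smul_add]
  | tmul w z => simp [mul_smul]

theorem smul_eq_iff_weight (χ ψ : Γ →* ℂˣ) (g : Γ) (v w : W) :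
    (χ g : ℂ) • v = (ψ g : ℂ) • w ↔ v = ((ψ * χ⁻¹) g : ℂ) • w := by
  rw [← eq_inv_smul_iff₀ (χ g).ne_zero, smul_smul]
  simp [mul_comm]

/-- Maps from a character to the twist of `V` by a character are weight vectors of `V`. -/
def intertwiningEquivWeightSpace (V : Representation ℂ Γ W) (χ ψ : Γ →* ℂˣ) :
    IntertwiningMap (charRep ψ) (V.tprod (charRep χ)) ≃ₗ[ℂ] weightSpace V (ψ * χ⁻¹) where
  toFun t := ⟨TensorProduct.rid ℂ W (t 1), fun g => by
    rw [← smul_eq_iff_weight, ← rid_tprod_charRep, ← map_smul]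
    congr 1
    have h := t.isIntertwining _ _ g 1
    rw [← h, ← map_smul]
    simp⟩
  map_add' s t := Subtype.ext (by simp)
  map_smul' c t := Subtype.ext (by simp)
  invFun v :=
    { toLinearMap := LinearMap.toSpanSingleton ℂ _ ((TensorProduct.rid ℂ W).symm v)
      isIntertwining' := fun g => by
        ext
        apply (TensorProduct.rid ℂ W).injective
        have h := (smul_eq_iff_weight χ ψ g _ _).2 (v.2 g)
        simpa [rid_tprod_charRep] using h.symm }
  left_inv t := by
    ext
    simp
  right_inv v := by
    ext
    simp

/-- An intertwining map from `ψ` to `V ⊗ χ` is determined by the image of 1, which is a vector of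
weight `ψχ⁻¹` in `V`. -/
theorem mult_charClass [Finite Γ] [IsMulCommutative Γ] (V : Representation ℂ Γ W)
    (χ ψ : Γ →* ℂˣ) :
    mult V (charClass χ) (charClass ψ) = Module.finrank ℂ (weightSpace V (ψ * χ⁻¹)) := by
  obtain ⟨e⟩ := charRep_equiv_rep χ
  obtain ⟨f⟩ := charRep_equiv_rep ψ
  let e' : (V.tprod (charClass χ).rep.ρ).Equiv (V.tprod (charRep χ)) :=
    Representation.Equiv.mk (TensorProduct.congr (LinearEquiv.refl ℂ W) e.symm.toLinearEquiv)
      fun g => by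
        ext w x
        have h := e.symm.toIntertwiningMap.isIntertwining _ _ g x
        simpa using congrArg (fun y => V g w ⊗ₜ[ℂ] y) h
  rw [mult, finrank_intertwining_congr f.symm e',
    (intertwiningEquivWeightSpace V χ ψ).finrank_eq]

open Classical in
theorem finrank_weightSpace_charRep (χ θ : Γ →* ℂˣ) :
    Module.finrank ℂ (weightSpace (charRep χ) θ) = if θ = χ then 1 else 0 := by
  split_ifs with h
  · have : weightSpace (charRep χ) θ = ⊤ := by
      subst h
      exact (Submodule.eq_top_iff').2 fun z g => rfl
    rw [this, finrank_top, Module.finrank_self]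
  · have : weightSpace (charRep χ) θ = ⊥ := by
      refine (Submodule.eq_bot_iff _).2 fun z hz => ?_
      by_contra hz0
      refine h (MonoidHom.ext fun g => Units.ext ?_)
      exact mul_right_cancel₀ hz0 (hz g).symm
    rw [this, finrank_bot]

/-- Weight multiplicities are additive. -/
theorem finrank_weightSpace_add {Γ' W₁ W₂ : Type} [Group Γ'] [AddCommGroup W₁] [Module ℂ W₁]
    [AddCommGroup W₂] [Module ℂ W₂] [FiniteDimensional ℂ W₁] [FiniteDimensional ℂ W₂]
    (φ : Γ' ≃* Γ) (V : Representation ℂ Γ W) (V₁ : Representation ℂ Γ' W₁)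
    (V₂ : Representation ℂ Γ' W₂) (E : (W₁ × W₂) ≃ₗ[ℂ] W)
    (hE : ∀ g x, V (φ g) (E x) = E (V₁ g x.1, V₂ g x.2)) (θ : Γ' →* ℂˣ) :
    Module.finrank ℂ (weightSpace V (θ.comp φ.symm.toMonoidHom)) =
      Module.finrank ℂ (weightSpace V₁ θ) + Module.finrank ℂ (weightSpace V₂ θ) := by
  have h : weightSpace V (θ.comp φ.symm.toMonoidHom) =
      ((weightSpace V₁ θ).prod (weightSpace V₂ θ)).map E.toLinearMap := by
    ext v
    obtain ⟨x, rfl⟩ := E.surjective v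
    rw [mem_weightSpace, φ.surjective.forall]
    simp [hE, mem_weightSpace, ← map_smul, Prod.ext_iff, forall_and]
  rw [h, LinearEquiv.finrank_map_eq, ← Module.finrank_prod]
  exact LinearEquiv.finrank_eq
    { toFun := fun x => (⟨x.1.1, x.2.1⟩, ⟨x.1.2, x.2.2⟩)
      map_add' := fun _ _ => rfl
      map_smul' := fun _ _ => rfl
      invFun := fun x => ⟨(x.1, x.2), x.1.2, x.2.2⟩
      left_inv := fun _ => rfl
      right_inv := fun _ => rfl }

end weights

/-! ### The Nakayama translation as a determinant twist, and comparison of quivers -/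

section translation

variable {Γ : Type} [Group Γ] [Finite Γ] [IsMulCommutative Γ] {W : Type} [AddCommGroup W]
  [Module ℂ W]

/-- The permutation of the irreducible representations given by the tensor product with the
determinant of `V`. -/
def detTranslation (V : Representation ℂ Γ W) : Equiv.Perm (IrrClass Γ) :=
  (charClass.symm.trans (Equiv.mulRight (detChar V))).trans charClass

theorem detTranslation_charClass (V : Representation ℂ Γ W) (χ : Γ →* ℂˣ) :
    detTranslation V (charClass χ) = charClass (χ * detChar V) := by
  simp [detTranslation]

theorem isNakayamaTranslation_detTranslation [FiniteDimensional ℂ W]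
    (V : Representation ℂ Γ W) : IsNakayamaTranslation V (detTranslation V) := by
  intro i
  obtain ⟨χ, rfl⟩ := charClass.surjective i
  obtain ⟨e⟩ := charRep_equiv_rep χ
  rw [detTranslation_charClass]
  obtain ⟨f⟩ := charRep_equiv_rep (χ * detChar V)
  exact ⟨ExtModule V χ, inferInstance, inferInstance, ExtModule.proj V e,
    ExtModule.isProjectiveCover_proj e, ExtModule.nonempty_socle_equiv f⟩

/-- The bijection on irreducible representations induced by an isomorphism of groups. -/
def transport {Γ' : Type} [Group Γ'] [Finite Γ'] [IsMulCommutative Γ'] (φ : Γ' ≃* Γ) :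
    IrrClass Γ' ≃ IrrClass Γ :=
  (charClass.symm.trans
    { toFun := fun χ => χ.comp φ.symm.toMonoidHom
      invFun := fun χ => χ.comp φ.toMonoidHom
      left_inv := fun χ => by ext; simp
      right_inv := fun χ => by ext; simp }).trans charClass

theorem transport_charClass {Γ' : Type} [Group Γ'] [Finite Γ'] [IsMulCommutative Γ']
    (φ : Γ' ≃* Γ) (χ : Γ' →* ℂˣ) :
    transport φ (charClass χ) = charClass (χ.comp φ.symm.toMonoidHom) := by
  simp [transport]

theorem nonempty_transport_equiv {Γ' : Type} [Group Γ'] [Finite Γ'] [IsMulCommutative Γ']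
    (φ : Γ' ≃* Γ) (i : IrrClass Γ') :
    Nonempty (Representation.Equiv ((transport φ i).rep.ρ.comp φ.toMonoidHom) i.rep.ρ) := by
  obtain ⟨χ, rfl⟩ := charClass.surjective i
  obtain ⟨e⟩ := charRep_equiv_rep χ
  rw [transport_charClass]
  obtain ⟨f⟩ := charRep_equiv_rep (χ.comp φ.symm.toMonoidHom)
  refine ⟨.mk (f.toLinearEquiv.symm.trans e.toLinearEquiv) fun g => LinearMap.ext fun x => ?_⟩
  change e.toLinearEquiv (f.toLinearEquiv.symm ((charClass _).rep.ρ (φ g) x)) =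
    (charClass χ).rep.ρ g (e.toLinearEquiv (f.toLinearEquiv.symm x))
  rw [equiv_charRep_apply e, equiv_charRep_apply f, map_smul, map_smul]
  simp

/-- If `V` restricts to `V' ⊕ det(V')⁻¹`, then its McKay quiver is that of `V'` with the Nakayama
translation added. -/
theorem isQuiverIso_transport {Γ' W' : Type} [Group Γ'] [Finite Γ'] [IsMulCommutative Γ']
    [AddCommGroup W'] [Module ℂ W'] [FiniteDimensional ℂ W'] (φ : Γ' ≃* Γ)
    (V : Representation ℂ Γ W) (V' : Representation ℂ Γ' W') (E : (W' × ℂ) ≃ₗ[ℂ] W)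
    (hE : ∀ g x, V (φ g) (E x) = E (V' g x.1, (LinearMap.det (V' g))⁻¹ * x.2)) :
    IsQuiverIso (addTranslationArrows (mcKayQuiver V') (detTranslation V')) (mcKayQuiver V)
      (transport φ) := by
  classical
  intro i j
  obtain ⟨χ, rfl⟩ := charClass.surjective i
  obtain ⟨ψ, rfl⟩ := charClass.surjective j
  have h := finrank_weightSpace_add φ V V' (charRep (detChar V')⁻¹) E
    (fun g x => by rw [hE]; simp) (ψ * χ⁻¹)
  have hχ : (ψ * χ⁻¹).comp φ.symm.toMonoidHom =
      ψ.comp φ.symm.toMonoidHom * (χ.comp φ.symm.toMonoidHom)⁻¹ := rfl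
  rw [hχ, ← mult_charClass, ← mult_charClass, ← transport_charClass, ← transport_charClass,
    finrank_weightSpace_charRep] at h
  -- The extra summand of `V` contributes exactly where the translation has an arrow, with the
  -- orientation `σ ψ → ψ`.
  have hiff : ψ * χ⁻¹ = (detChar V')⁻¹ ↔
      charClass χ = detTranslation V' (charClass ψ) := by
    have hgroup : ∀ {A : Type} [CommGroup A] (a b c : A), b * a⁻¹ = c⁻¹ ↔ a = b * c := by
      intro A _ a b c
      rw [mul_inv_eq_iff_eq_mul, eq_inv_mul_iff_mul_eq, mul_comm, eq_comm]
    rw [detTranslation_charClass, charClass.apply_eq_iff_eq]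
    exact hgroup (A := Γ' →* ℂˣ) _ _ _
  change Nonempty ((Fin (mult V' _ _) ⊕ PLift (charClass χ = detTranslation V' (charClass ψ))) ≃
    Fin (mult V _ _))
  refine Fintype.card_eq.1 ?_
  rw [Fintype.card_sum, Fintype.card_fin, Fintype.card_fin, h]
  congr 1
  by_cases h' : charClass χ = detTranslation V' (charClass ψ)
  · have : Unique (PLift (charClass χ = detTranslation V' (charClass ψ))) :=
      ⟨⟨⟨h'⟩⟩, fun _ => rfl⟩
    rw [if_pos (hiff.2 h'), Fintype.card_unique]
  · rw [if_neg (hiff.not.2 h'), Fintype.card_eq_zero_iff]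
    exact ⟨fun x => h' x.down⟩

end translation

/-! ### Conjugating a finite abelian subgroup into block diagonal form -/

open scoped IsMulCommutative in
/-- A representation of a finite commutative group has an invariant line with an invariant
complement. -/
theorem exists_invariant_line {Γ M : Type} [Group Γ] [Finite Γ] [IsMulCommutative Γ]
    [AddCommGroup M] [Module ℂ M] [FiniteDimensional ℂ M] [Nontrivial M]
    (ρ : Representation ℂ Γ M) :
    ∃ H L : Submodule ℂ M, IsCompl H L ∧ Module.finrank ℂ L = 1 ∧
      (∀ g, ∀ x ∈ H, ρ g x ∈ H) ∧ ∀ g, ∀ x ∈ L, ρ g x ∈ L := by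
  -- Invertibility of the group order is what Maschke's theorem needs, both for a simple submodule
  -- and for its complement.
  have : NeZero (Nat.card Γ : ℂ) := ⟨Nat.cast_ne_zero.2 Nat.card_pos.ne'⟩
  have : Nontrivial ρ.asModule := inferInstanceAs (Nontrivial M)
  have : FiniteDimensional ℂ ρ.asModule := inferInstanceAs (FiniteDimensional ℂ M)
  obtain ⟨K, hK⟩ := IsSemisimpleModule.exists_simple_submodule (MonoidAlgebra ℂ Γ) ρ.asModule
  obtain ⟨K', hK'⟩ := MonoidAlgebra.Submodule.exists_isCompl K
  have hfin : FiniteDimensional ℂ K :=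
    inferInstanceAs (FiniteDimensional ℂ (K.restrictScalars ℂ))
  have h1 : Module.finrank ℂ K = 1 :=
    IsSimpleModule.finrank_eq_one_of_isMulCommutative (MonoidAlgebra ℂ Γ) K ℂ
  let f := (Subrepresentation.subrepresentationSubmoduleOrderIso (ρ := ρ)).symm
  refine ⟨(f K').toSubmodule, (f K).toSubmodule, ?_, h1,
    fun g x hx => (f K').apply_mem_toSubmodule g hx,
    fun g x hx => (f K).apply_mem_toSubmodule g hx⟩
  have h := f.isCompl_iff.1 hK'.symm
  refine ⟨disjoint_iff.2 ?_, codisjoint_iff.2 ?_⟩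
  · exact congrArg Subrepresentation.toSubmodule h.inf_eq_bot
  · exact congrArg Subrepresentation.toSubmodule h.sup_eq_top

/-- The basis of `ℂ^(n + 1)` given by bases of complementary subspaces of dimensions `n` and `1`. -/
def complBasis {n : ℕ} {H L : Submodule ℂ (Fin (n + 1) → ℂ)} (hHL : IsCompl H L)
    (bH : Module.Basis (Fin n) ℂ H) (bL : Module.Basis (Fin 1) ℂ L) :
    Module.Basis (Fin (n + 1)) ℂ (Fin (n + 1) → ℂ) :=
  ((bH.prod bL).map (Submodule.prodEquivOfIsCompl H L hHL)).reindex finSumFinEquiv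

section complBasis

variable {n : ℕ} {H L : Submodule ℂ (Fin (n + 1) → ℂ)} (hHL : IsCompl H L)
  (bH : Module.Basis (Fin n) ℂ H) (bL : Module.Basis (Fin 1) ℂ L)

@[simp]
theorem complBasis_inl (i : Fin n) :
    complBasis hHL bH bL (finSumFinEquiv (Sum.inl i)) = bH i := by
  simp [complBasis, -finSumFinEquiv_apply_left]

@[simp]
theorem complBasis_inr (i : Fin 1) :
    complBasis hHL bH bL (finSumFinEquiv (Sum.inr i)) = bL i := by
  simp [complBasis, -finSumFinEquiv_apply_right]

theorem complBasis_repr_inl {x : Fin (n + 1) → ℂ} (hx : x ∈ L) (i : Fin n) :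
    (complBasis hHL bH bL).repr x (finSumFinEquiv (Sum.inl i)) = 0 := by
  simp [complBasis, -finSumFinEquiv_apply_left,
    (Submodule.projectionOnto_apply_eq_zero_iff hHL).2 hx]

theorem complBasis_repr_inr {x : Fin (n + 1) → ℂ} (hx : x ∈ H) (i : Fin 1) :
    (complBasis hHL bH bL).repr x (finSumFinEquiv (Sum.inr i)) = 0 := by
  simp [complBasis, -finSumFinEquiv_apply_right,
    (Submodule.projectionOnto_apply_eq_zero_iff hHL.symm).2 hx]

/-- The basis of the line can be rescaled so that the basis of `ℂ^(n + 1)` has determinant `1`. -/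
theorem exists_det_complBasis_eq_one (hL : Module.finrank ℂ L = 1) :
    ∃ bL : Module.Basis (Fin 1) ℂ L,
      (Pi.basisFun ℂ (Fin (n + 1))).det (complBasis hHL bH bL) = 1 := by
  let bL : Module.Basis (Fin 1) ℂ L := Module.finBasisOfFinrankEq ℂ L hL
  have hu := (Pi.basisFun ℂ (Fin (n + 1))).isUnit_det (complBasis hHL bH bL)
  -- Only the vector spanning the line is rescaled, so the determinant is multiplied by this one
  -- factor.
  let w : Fin 1 → ℂˣ := fun _ => hu.unit⁻¹
  refine ⟨bL.unitsSMul w, ?_⟩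
  let c : Fin (n + 1) → ℂ := fun i =>
    Sum.elim (fun _ => 1) (fun k => (w k : ℂ)) (finSumFinEquiv.symm i)
  have h : ⇑(complBasis hHL bH (bL.unitsSMul w)) = fun i => c i • complBasis hHL bH bL i := by
    funext i
    obtain ⟨i | i, rfl⟩ := finSumFinEquiv.surjective i
    · simp [c, -finSumFinEquiv_apply_left]
    · simp [c, -finSumFinEquiv_apply_right, Module.Basis.unitsSMul_apply, Units.smul_def]
  have hc : ∏ i, c i = (hu.unit⁻¹ : ℂˣ) := by
    rw [← finSumFinEquiv.prod_comp]
    simp [c, w, -finSumFinEquiv_apply_left, -finSumFinEquiv_apply_right]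
  rw [h, AlternatingMap.map_smul_univ, hc, smul_eq_mul]
  exact hu.val_inv_mul

end complBasis

/-- A finite commutative subgroup of `SL(n + 1, ℂ)` is conjugate to a group of block diagonal
matrices with blocks of sizes `n` and `1`. -/
theorem exists_conj_mem_range_detEmbedding {n : ℕ}
    (G : Subgroup (Matrix.SpecialLinearGroup (Fin (n + 1)) ℂ)) [Finite G] [IsMulCommutative G] :
    ∃ P : Matrix.SpecialLinearGroup (Fin (n + 1)) ℂ,
      ∀ g ∈ G, ∃ A : GL (Fin n) ℂ, g = P * detEmbedding n A * P⁻¹ := by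
  obtain ⟨H, L, hHL, hL, hH, hL'⟩ := exists_invariant_line (slRep G)
  have hHn : Module.finrank ℂ H = n := by
    have := Submodule.finrank_add_eq_of_isCompl hHL
    rw [hL, Module.finrank_fin_fun] at this
    omega
  let bH : Module.Basis (Fin n) ℂ H := Module.finBasisOfFinrankEq ℂ H hHn
  obtain ⟨bL, hdet⟩ := exists_det_complBasis_eq_one hHL bH hL
  let b := complBasis hHL bH bL
  let P : Matrix.SpecialLinearGroup (Fin (n + 1)) ℂ :=
    ⟨(Pi.basisFun ℂ (Fin (n + 1))).toMatrix b, hdet⟩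
  refine ⟨P, fun g hg => ?_⟩
  let M := P⁻¹ * g * P
  -- The columns of `P` are the vectors of `b`, so `M` is the matrix of `g` in the basis `b`;
  -- invariance of `H` and `L` will kill its off-diagonal blocks.
  have hM : ∀ i j, M i j = b.repr ((g : Matrix (Fin (n + 1)) (Fin (n + 1)) ℂ).mulVec (b j)) i := by
    intro i j
    have hPM : P * M = g * P := by simp [M, mul_assoc]
    have hsum : ∑ k, M k j • b k = (g : Matrix (Fin (n + 1)) (Fin (n + 1)) ℂ).mulVec (b j) := by
      funext i
      have h : ((P : Matrix (Fin (n + 1)) (Fin (n + 1)) ℂ) * M) i j =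
          ((g : Matrix (Fin (n + 1)) (Fin (n + 1)) ℂ) * P) i j :=
        congrArg (fun X : Matrix.SpecialLinearGroup (Fin (n + 1)) ℂ => X i j) hPM
      simpa [Matrix.mul_apply, Matrix.mulVec, dotProduct, P, Module.Basis.toMatrix_apply,
        mul_comm] using h
    rw [← hsum, b.repr_sum_self]
  let B : Matrix (Fin n ⊕ Fin 1) (Fin n ⊕ Fin 1) ℂ :=
    (M : Matrix (Fin (n + 1)) (Fin (n + 1)) ℂ).submatrix finSumFinEquiv finSumFinEquiv
  have h12 : B.toBlocks₁₂ = 0 := by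
    ext i j
    refine (hM _ _).trans (complBasis_repr_inl hHL bH bL ?_ i)
    rw [complBasis_inr]
    exact hL' ⟨g, hg⟩ _ (bL j).2
  have h21 : B.toBlocks₂₁ = 0 := by
    ext i j
    refine (hM _ _).trans (complBasis_repr_inr hHL bH bL ?_ i)
    rw [complBasis_inl]
    exact hH ⟨g, hg⟩ _ (bH j).2
  have hB : B = Matrix.fromBlocks B.toBlocks₁₁ 0 0 B.toBlocks₂₂ := by
    rw [← h12, ← h21, Matrix.fromBlocks_toBlocks]
  have hdetB : B.toBlocks₁₁.det * B.toBlocks₂₂.det = 1 := by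
    rw [← Matrix.det_fromBlocks_zero₂₁ _ 0, ← hB, Matrix.det_submatrix_equiv_self]
    exact M.2
  have h11 : B.toBlocks₁₁.det ≠ 0 := left_ne_zero_of_mul_eq_one hdetB
  refine ⟨Matrix.GeneralLinearGroup.mkOfDetNeZero B.toBlocks₁₁ h11, ?_⟩
  have h22 : B.toBlocks₂₂ = Matrix.diagonal fun _ => (B.toBlocks₁₁.det)⁻¹ := by
    ext i j
    rw [Subsingleton.elim i 0, Subsingleton.elim j 0, Matrix.diagonal_apply_eq,
      ← eq_inv_of_mul_eq_one_right hdetB, Matrix.det_fin_one]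
  have hA : detEmbedding n (Matrix.GeneralLinearGroup.mkOfDetNeZero B.toBlocks₁₁ h11) = M := by
    apply Subtype.ext
    change detBlock B.toBlocks₁₁ = M
    rw [detBlock, ← h22, ← hB]
    ext i j
    simp [B]
  rw [hA]
  simp [M, mul_assoc]

theorem detEmbedding_injective (n : ℕ) : Function.Injective (detEmbedding n) := by
  intro A B h
  have h' := congrArg Subtype.val h
  change detBlock (A : Matrix (Fin n) (Fin n) ℂ) = detBlock (B : Matrix (Fin n) (Fin n) ℂ) at h'
  have h'' := (Matrix.reindexAlgEquiv ℂ ℂ finSumFinEquiv).injective h'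
  exact Units.ext (Matrix.fromBlocks_inj.1 h'').1

/-- The identification `ℂ^n × ℂ ≅ ℂ^(n + 1)`. -/
def appendEquiv (n : ℕ) : ((Fin n → ℂ) × ℂ) ≃ₗ[ℂ] (Fin (n + 1) → ℂ) :=
  ((LinearEquiv.refl ℂ (Fin n → ℂ)).prodCongr (LinearEquiv.funUnique (Fin 1) ℂ ℂ).symm).trans
    ((LinearEquiv.sumArrowLequivProdArrow (Fin n) (Fin 1) ℂ ℂ).symm.trans
      (LinearEquiv.funCongrLeft ℂ ℂ finSumFinEquiv.symm))

theorem detBlock_mulVec_appendEquiv {n : ℕ} (A : Matrix (Fin n) (Fin n) ℂ)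
    (x : (Fin n → ℂ) × ℂ) :
    (detBlock A).mulVec (appendEquiv n x) = appendEquiv n (A.mulVec x.1, (A.det)⁻¹ * x.2) := by
  have h : ∀ y : (Fin n → ℂ) × ℂ,
      appendEquiv n y = Sum.elim y.1 (fun _ => y.2) ∘ finSumFinEquiv.symm := by
    intro y
    funext i
    obtain ⟨i | i, rfl⟩ := finSumFinEquiv.surjective i <;> rfl
  rw [h, h, detBlock, Matrix.coe_reindexAlgEquiv, Matrix.reindex_apply,
    Matrix.submatrix_mulVec_equiv]
  simp only [Equiv.symm_symm, Function.comp_assoc, Equiv.symm_comp_self, Function.comp_id,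
    Matrix.fromBlocks_mulVec]
  congr 1
  ext i
  cases i <;> simp

end McKay

end

/-! ### Assembly -/

theorem mainTheorem6 {n : ℕ} (G : Subgroup (Matrix.SpecialLinearGroup (Fin (n + 1)) ℂ))
    [Finite G] (hG : ∀ x ∈ G, ∀ y ∈ G, x * y = y * x) :
    ∃ (G' : Subgroup (GL (Fin n) ℂ)) (P : Matrix.SpecialLinearGroup (Fin (n + 1)) ℂ),
      Finite G' ∧
      G = (G'.map (McKay.detEmbedding n)).map (MulAut.conj P).toMonoidHom ∧
      ∃ (φ : G' ≃* G) (Φ : McKay.IrrClass G' ≃ McKay.IrrClass G)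
        (σ : Equiv.Perm (McKay.IrrClass G')),
        (∀ g : G', (φ g : Matrix.SpecialLinearGroup (Fin (n + 1)) ℂ) =
          P * McKay.detEmbedding n g * P⁻¹) ∧
        (∀ i : McKay.IrrClass G',
          Nonempty (Representation.Equiv ((Φ i).rep.ρ.comp φ.toMonoidHom) i.rep.ρ)) ∧
        McKay.IsNakayamaTranslation (McKay.glRep G') σ ∧
        McKay.IsQuiverIso
          (McKay.addTranslationArrows (McKay.mcKayQuiver (McKay.glRep G')) σ)
          (McKay.mcKayQuiver (McKay.slRep G)) Φ := by
  have hcomm : IsMulCommutative G := ⟨⟨fun x y => Subtype.ext (hG x x.2 y y.2)⟩⟩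
  obtain ⟨P, hP⟩ := McKay.exists_conj_mem_range_detEmbedding G
  let f : GL (Fin n) ℂ →* Matrix.SpecialLinearGroup (Fin (n + 1)) ℂ :=
    (MulAut.conj P).toMonoidHom.comp (McKay.detEmbedding n)
  have hf : Function.Injective f :=
    (MulAut.conj P).injective.comp (McKay.detEmbedding_injective n)
  have hrange : G ≤ f.range := fun g hg => by
    obtain ⟨A, hA⟩ := hP g hg
    exact ⟨A, hA.symm⟩
  -- `G'` is the full preimage of `G` under `A ↦ P * detEmbedding n A * P⁻¹`; this map is injective
  -- with range containing `G`, so it restricts to an isomorphism.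
  let φ : G.comap f ≃* G := MulEquiv.ofBijective (f.subgroupComap G)
    ⟨fun x y h => Subtype.ext (hf (congrArg Subtype.val h)), fun g => by
      obtain ⟨A, hA⟩ := hrange g.2
      exact ⟨⟨A, show f A ∈ G from hA ▸ g.2⟩, Subtype.ext hA⟩⟩
  have hfin : Finite (G.comap f) := Finite.of_equiv G φ.symm.toEquiv
  have hcomm' : IsMulCommutative (G.comap f) :=
    ⟨⟨fun x y => φ.injective (by rw [map_mul, map_mul, hcomm.is_comm.comm])⟩⟩
  refine ⟨G.comap f, P, hfin, ?_, φ, McKay.transport φ,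
    McKay.detTranslation (McKay.glRep (G.comap f)), fun g => rfl,
    McKay.nonempty_transport_equiv φ,
    McKay.isNakayamaTranslation_detTranslation _, ?_⟩
  · rw [Subgroup.map_map, Subgroup.map_comap_eq, inf_eq_right.2 hrange]
  · refine McKay.isQuiverIso_transport φ _ _
      -- Changing coordinates by `P` turns the action of `φ g` into that of the block matrix of `g`.
      ((McKay.appendEquiv n).trans (Matrix.SpecialLinearGroup.toLin' P)) fun g x => ?_
    have hdet : LinearMap.det (McKay.glRep (G.comap f) g) =
        ((g : GL (Fin n) ℂ) : Matrix (Fin n) (Fin n) ℂ).det := LinearMap.det_toLin' _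
    rw [hdet]
    change ((P * McKay.detEmbedding n g * P⁻¹ : Matrix.SpecialLinearGroup (Fin (n + 1)) ℂ) :
      Matrix (Fin (n + 1)) (Fin (n + 1)) ℂ).mulVec
        ((P : Matrix (Fin (n + 1)) (Fin (n + 1)) ℂ).mulVec (McKay.appendEquiv n x)) =
      (P : Matrix (Fin (n + 1)) (Fin (n + 1)) ℂ).mulVec (McKay.appendEquiv n
        (((g : GL (Fin n) ℂ) : Matrix (Fin n) (Fin n) ℂ).mulVec x.1, _))
    rw [Matrix.mulVec_mulVec, ← Matrix.SpecialLinearGroup.coe_mul, inv_mul_cancel_right,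
      Matrix.SpecialLinearGroup.coe_mul, ← Matrix.mulVec_mulVec,
      ← McKay.detBlock_mulVec_appendEquiv]
    rfl
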